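/- For a topological space $X$, let $d(X)$ be the least cardinality of a dense subset of $X$, and let the tightness $t(X)$ be the least infinite cardinal $\kappa$ such that whenever $A\subseteq X$ and $x\in\overline{A}$ there is $B\subseteq A$ with $|B|\le\kappa$ and $x\in\overline{B}$. For a cardinal $\lambda$ and $A\subseteq X$ put $\mathrm{cl}_\lambda A=\bigcup\{\overline{B}: B\subseteq A,\ |B|\le\lambda\}$. The weak tightness $wt(X)$ is the least infinite cardinal $\kappa$ for which there is a cover $\mathcal{C}$ of $X$ such that $|\mathcal{C}|\le 2^\kappa$ and every $C\in\mathcal{C}$ (with the subspace topology) satisfies $t(C)\le\kappa$ and $X=\mathrm{cl}_{2^\kappa}C$. A space $X$ is homogeneous if for all $x,y\in X$ there is a homeomorphism $h:X\to X$ with $h(x)=y$, and power homogeneous if there is a nonzero cardinal $\mu$ such that the product space $X^\mu$ is homogeneous. Theorem. If $X$ is a power homogeneous compact Hausdorff space, then $d(X)\le 2^{wt(X)}$. -/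

import Mathlib

open Cardinal

universe u v

/-- The density `d(X)`: the least cardinality of a dense subset. -/
noncomputable def density (X : Type u) [TopologicalSpace X] : Cardinal.{u} :=
  sInf {c | ∃ D : Set X, Dense D ∧ #D = c}

/-- `κ` bounds the tightness of `X`: each point in the closure of a set `A` is in the closure of
a subset of `A` of cardinality at most `κ`. -/
def TightnessBound (X : Type u) [TopologicalSpace X] (κ : Cardinal.{u}) : Prop :=
  ∀ (A : Set X) (x : X), x ∈ closure A → ∃ B ⊆ A, #B ≤ κ ∧ x ∈ closure B

/-- The tightness `t(X)`: the least infinite cardinal bounding the tightness of `X`. -/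
noncomputable def tightness (X : Type u) [TopologicalSpace X] : Cardinal.{u} :=
  sInf {κ | ℵ₀ ≤ κ ∧ TightnessBound X κ}

/-- The `κ`-closure of `A`: the union of the closures of the subsets of `A` of cardinality
at most `κ`. -/
def cardClosure {X : Type u} [TopologicalSpace X] (κ : Cardinal.{u}) (A : Set X) : Set X :=
  ⋃ B ∈ {B : Set X | B ⊆ A ∧ #B ≤ κ}, closure B

/-- `𝒞` is a cover of `X` by at most `2 ^ κ` sets `C`, each (as a subspace) of tightness at
most `κ` and with `2 ^ κ`-closure equal to `X`. -/
structure IsWeakTightnessCover {X : Type u} [TopologicalSpace X] (κ : Cardinal.{u})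
    (𝒞 : Set (Set X)) : Prop where
  cover : ⋃₀ 𝒞 = Set.univ
  card_le : #𝒞 ≤ 2 ^ κ
  tightness_le : ∀ C ∈ 𝒞, tightness C ≤ κ
  cardClosure_eq : ∀ C ∈ 𝒞, cardClosure (2 ^ κ) C = Set.univ

/-- The weak tightness `wt(X)`: the least infinite cardinal `κ` for which such a cover exists. -/
noncomputable def weakTightness (X : Type u) [TopologicalSpace X] : Cardinal.{u} :=
  sInf {κ | ℵ₀ ≤ κ ∧ ∃ 𝒞 : Set (Set X), IsWeakTightnessCover κ 𝒞}

/-- For any two points, some homeomorphism of `X` onto itself takes one to the other. -/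
def IsHomogeneousSpace (X : Type*) [TopologicalSpace X] : Prop :=
  ∀ x y : X, ∃ h : X ≃ₜ X, h x = y

/-- Some power of `X` with nonzero exponent, with the product topology, is homogeneous. -/
def IsPowerHomogeneous (X : Type u) [TopologicalSpace X] : Prop :=
  ∃ ι : Type v, Nonempty ι ∧ IsHomogeneousSpace (ι → X)

/-! The minima above are over nonempty sets, hence attained. -/

theorem density_spec (X : Type u) [TopologicalSpace X] :
    ∃ D : Set X, Dense D ∧ #D = density X :=
  csInf_mem (s := {c | ∃ D : Set X, Dense D ∧ #D = c}) ⟨_, Set.univ, dense_univ, rfl⟩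

theorem tightnessBound_max (X : Type u) [TopologicalSpace X] :
    TightnessBound X (max ℵ₀ #X) := fun A _ hx =>
  ⟨A, subset_rfl, (mk_set_le A).trans (le_max_right _ _), hx⟩

theorem tightness_spec (X : Type u) [TopologicalSpace X] :
    ℵ₀ ≤ tightness X ∧ TightnessBound X (tightness X) :=
  csInf_mem (s := {κ | ℵ₀ ≤ κ ∧ TightnessBound X κ})
    ⟨_, le_max_left _ _, tightnessBound_max X⟩

theorem weakTightness_spec (X : Type u) [TopologicalSpace X] :
    ℵ₀ ≤ weakTightness X ∧ ∃ 𝒞 : Set (Set X), IsWeakTightnessCover (weakTightness X) 𝒞 := by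
  refine csInf_mem (s := {κ | ℵ₀ ≤ κ ∧ ∃ 𝒞 : Set (Set X), IsWeakTightnessCover κ 𝒞})
    ⟨max ℵ₀ #X, le_max_left _ _, {Set.univ}, ⟨by simp, ?_, ?_, ?_⟩⟩
  · rw [mk_singleton]
    exact (one_lt_aleph0.le.trans (le_max_left _ _)).trans (cantor _).le
  · rintro C rfl
    refine csInf_le' ⟨le_max_left _ _, fun A x hx => ⟨A, subset_rfl, ?_, hx⟩⟩
    exact (mk_set_le A).trans ((mk_set_le _).trans (le_max_right _ _))
  · rintro C rfl
    refine Set.eq_univ_of_forall fun x => ?_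
    refine Set.mem_biUnion (x := Set.univ) ⟨subset_rfl, ?_⟩ (subset_closure (Set.mem_univ x))
    exact (mk_set_le _).trans ((le_max_right ℵ₀ _).trans (cantor _).le)

/-! Let `κ = wt(X)`. A closure point of a saturated set is in the closure of at most `κ` of its
points, and every point lies in a saturated set of size at most `2 ^ κ`. A free-sequence argument of
length `κ⁺` (`exists_image_subset_closure`) then gives a nonempty intersection `G` of `κ` zero sets
inside the closure of `2 ^ κ` points. It also shows that a continuous map from a power of `X` to `X`
has its values in such a closure once `κ` suitable coordinates are fixed. Finally, `2 ^ κ` closed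
sets separate the points of `G` from all other points.

Fix `p ∈ G` and homeomorphisms `h x` of the power taking the constant point `x` to the constant
point `p`; changing one coordinate to `v` before applying `h x` gives `z x v`, with `z x x`
constantly `p`. Let `D` be a set of size at most `2 ^ κ` closed under the relevant choices. If `y ∉
closure D`, compactness gives `n ∈ closure D` that the separating sets cannot tell from `y` using
parameters in `D`. Reflecting the homeomorphism at `n` into `D` gives `x ∈ D` for which the relevant
coordinates of `z x n` lie in `G`, hence equal those of `z x y`. A point of `D` near `n` then yields
points near `z x y` whose preimages under `h x` have the varied coordinate in `closure D`, forcing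
`y ∈ closure D`. -/

/-! ### Cardinality bookkeeping and closing off. -/

/-- `A` is contained in the range of some map from `K`. -/
def EnumeratedBy (K : Type*) {α : Type*} (A : Set α) : Prop :=
  ∃ e : K → α, A ⊆ Set.range e

namespace EnumeratedBy

variable {K : Type*} {α : Type*} {A B : Set α}

theorem range (e : K → α) : EnumeratedBy K (Set.range e) := ⟨e, subset_rfl⟩

theorem trans {L : Type*} (hK : EnumeratedBy L (Set.univ : Set K)) (hA : EnumeratedBy K A) :
    EnumeratedBy L A := by
  obtain ⟨e, he⟩ := hK
  obtain ⟨f, hf⟩ := hA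
  refine ⟨f ∘ e, fun a ha => ?_⟩
  obtain ⟨k, rfl⟩ := hf ha
  obtain ⟨l, rfl⟩ := he (Set.mem_univ k)
  exact ⟨l, rfl⟩

theorem of_mk_le {K α : Type u} [Nonempty α] {A : Set α} (h : #A ≤ #K) : EnumeratedBy K A := by
  obtain ⟨f⟩ := h
  refine ⟨Function.extend f (fun a => (a : α)) fun _ => Classical.arbitrary α, fun a ha => ?_⟩
  exact ⟨f ⟨a, ha⟩, f.injective.extend_apply _ _ _⟩

theorem mk_le {K α : Type u} {A : Set α} (h : EnumeratedBy K A) : #A ≤ #K := by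
  obtain ⟨e, he⟩ := h
  exact (mk_le_mk_of_subset he).trans mk_range_le

theorem iUnion [Infinite K] {I : Type*} {A : I → Set α}
    (hI : EnumeratedBy K (Set.univ : Set I)) (hA : ∀ i, EnumeratedBy K (A i)) :
    EnumeratedBy K (⋃ i, A i) := by
  obtain ⟨e, he⟩ := hI
  choose f hf using hA
  obtain ⟨E⟩ : Nonempty (K ≃ K × K) := by
    rw [← Cardinal.eq, mk_prod, lift_id, mul_eq_self (aleph0_le_mk K)]
  refine ⟨fun k => f (e (E k).1) (E k).2, Set.iUnion_subset fun i a ha => ?_⟩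
  obtain ⟨k, rfl⟩ := he (Set.mem_univ i)
  obtain ⟨l, rfl⟩ := hf _ ha
  exact ⟨E.symm (k, l), by simp⟩

theorem of_countable [Infinite K] [Nonempty α] (h : A.Countable) : EnumeratedBy K A := by
  obtain ⟨f, hf⟩ : ∃ f : ℕ → α, A ⊆ Set.range f := by
    rcases A.eq_empty_or_nonempty with rfl | hne
    · exact ⟨fun _ => Classical.arbitrary α, Set.empty_subset _⟩
    · obtain ⟨f, hf⟩ := h.exists_eq_range hne
      exact ⟨f, hf.le⟩
  exact trans ⟨Function.invFun (Infinite.natEmbedding K), fun n _ =>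
    (Function.invFun_surjective (Infinite.natEmbedding K).injective) n⟩ ⟨f, hf⟩

theorem union [Infinite K] [Nonempty α] (hA : EnumeratedBy K A) (hB : EnumeratedBy K B) :
    EnumeratedBy K (A ∪ B) := by
  rw [Set.union_eq_iUnion]
  exact iUnion (of_countable Set.countable_univ) (Bool.forall_bool.2 ⟨hB, hA⟩)

/-- A nonempty enumerated set is the range of an enumeration. -/
theorem exists_range_eq (hA : EnumeratedBy K A) (hne : A.Nonempty) :
    ∃ e : K → α, Set.range e = A := by
  classical
  obtain ⟨e, he⟩ := hA
  obtain ⟨a, ha⟩ := hne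
  refine ⟨fun k => if e k ∈ A then e k else a, ?_⟩
  ext b
  constructor
  · rintro ⟨k, rfl⟩
    dsimp only
    split_ifs with h
    exacts [h, ha]
  · intro hb
    obtain ⟨k, rfl⟩ := he hb
    exact ⟨k, if_pos hb⟩

end EnumeratedBy

/-- Closing off under at most `2 ^ #K` operations of arity `K`. -/
theorem exists_enumerated_closed {K L J X : Type u} [Infinite K] (hL : #L = 2 ^ #K)
    (hJ : #J ≤ #L) (op : J → (K → X) → X) (x₀ : X) :
    ∃ D : Set X, x₀ ∈ D ∧ EnumeratedBy L D ∧ ∀ j b, (∀ k, b k ∈ D) → op j b ∈ D := by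
  have hKω : ℵ₀ ≤ #K := aleph0_le_mk K
  have hLω : ℵ₀ ≤ #L := hL ▸ hKω.trans (cantor _).le
  -- Well-founded terms in one constant and a `K`-ary symbol for each `j`; `D` is the set of their
  -- values. They are few because `#L ^ #K = #L`.
  let β : Option J → Type u := fun o => o.elim PEmpty fun _ => K
  let ev : WType β → X := WType.elim X fun p =>
    match p with
    | ⟨none, _⟩ => x₀
    | ⟨some j, f⟩ => op j f
  have hW : #(WType β) ≤ #L := by
    refine WType.cardinalMk_le_of_le ?_
    have : ∀ o : Option J, #L ^ #(β o) ≤ #L := by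
      rintro (_ | j)
      · simpa [β] using one_le_aleph0.trans hLω
      · change #L ^ #K ≤ #L
        rw [hL, ← power_mul, mul_eq_self hKω]
    refine (sum_le_sum _ (fun _ => #L) this).trans ?_
    rw [sum_const', mk_option]
    refine (mul_le_mul_left (add_le_add hJ (one_le_aleph0.trans hLω)) _).trans ?_
    rw [add_eq_self hLω, mul_eq_self hLω]
  have : Nonempty X := ⟨x₀⟩
  refine ⟨Set.range ev, ⟨WType.mk none PEmpty.elim, rfl⟩,
    EnumeratedBy.of_mk_le (mk_range_le.trans hW), fun j b hb => ?_⟩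
  choose t ht using hb
  refine ⟨WType.mk (some j) t, ?_⟩
  change op j (fun k => ev (t k)) = op j b
  simp only [ht]

/-! ### Saturated sets. -/

section Saturated

variable {X : Type u} [TopologicalSpace X]

/-- `S ∩ C` is dense in `S` for every `C ∈ 𝒞`. -/
def IsSaturated (𝒞 : Set (Set X)) (S : Set X) : Prop :=
  ∀ C ∈ 𝒞, S ⊆ closure (S ∩ C)

variable {K L : Type u} {𝒞 : Set (Set X)} {S : Set X}

theorem IsSaturated.iUnion {I : Type*} {S : I → Set X} (hS : ∀ i, IsSaturated 𝒞 (S i)) :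
    IsSaturated 𝒞 (⋃ i, S i) := fun C hC => Set.iUnion_subset fun i =>
  (hS i C hC).trans (closure_mono (Set.inter_subset_inter_left _ (Set.subset_iUnion S i)))

theorem IsSaturated.inter_isOpen (hS : IsSaturated 𝒞 S) {O : Set X} (hO : IsOpen O) :
    IsSaturated 𝒞 (S ∩ O) := by
  rintro C hC x ⟨hx, hxO⟩
  have := hO.inter_closure ⟨hxO, hS C hC hx⟩
  exact closure_mono (show O ∩ (S ∩ C) ⊆ S ∩ O ∩ C from
    fun y hy => ⟨⟨hy.2.1, hy.1⟩, hy.2.2⟩) this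

/-- The point `z` lies in some `C` of the cover; saturation puts `z` in the closure of `S ∩ C`, and
the tightness of `C` applies. -/
theorem IsSaturated.exists_enumerated [Infinite K] (h𝒞 : IsWeakTightnessCover #K 𝒞)
    (hS : IsSaturated 𝒞 S) {z : X} (hz : z ∈ closure S) :
    ∃ B ⊆ S, EnumeratedBy K B ∧ z ∈ closure B := by
  have : Nonempty X := ⟨z⟩
  obtain ⟨C, hC, hzC⟩ : z ∈ ⋃₀ 𝒞 := h𝒞.cover ▸ Set.mem_univ z
  have hzS : z ∈ closure (S ∩ C) := closure_minimal (hS C hC) isClosed_closure hz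
  have hz' : (⟨z, hzC⟩ : C) ∈ closure ((↑) ⁻¹' S : Set C) := by
    rw [closure_subtype, Subtype.image_preimage_coe, Set.inter_comm]
    exact hzS
  obtain ⟨B, hBS, hB, hzB⟩ := (tightness_spec C).2 _ _ hz'
  refine ⟨(↑) '' B, ?_, ?_, closure_subtype.1 hzB⟩
  · rintro _ ⟨b, hb, rfl⟩
    exact hBS hb
  · exact EnumeratedBy.of_mk_le (mk_image_le.trans (hB.trans (h𝒞.tightness_le C hC)))

/-- Close `{x}` off under adding, for each point `y` and each `C`, a subset of `C` of size at most
`2 ^ #K` with `y` in its closure. -/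
theorem exists_saturated_superset [Infinite K] (hL : #L = 2 ^ #K)
    (h𝒞 : IsWeakTightnessCover #K 𝒞) (x : X) :
    ∃ S : Set X, x ∈ S ∧ IsSaturated 𝒞 S ∧ EnumeratedBy L S := by
  have : Nonempty X := ⟨x⟩
  have key : ∀ (C : 𝒞) (y : X), ∃ e : L → X, y ∈ closure (Set.range e ∩ C) := by
    intro C y
    have hy : y ∈ cardClosure (2 ^ #K) (C : Set X) :=
      h𝒞.cardClosure_eq C C.2 ▸ Set.mem_univ y
    simp only [cardClosure, Set.mem_iUnion] at hy
    obtain ⟨B, ⟨hBC, hB⟩, hyB⟩ := hy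
    obtain ⟨e, he⟩ := EnumeratedBy.of_mk_le (K := L) (hB.trans hL.ge)
    exact ⟨e, closure_mono (Set.subset_inter he hBC) hyB⟩
  choose e he using key
  have hLω : ℵ₀ ≤ #L := hL ▸ (aleph0_le_mk K).trans (cantor _).le
  have hJ : #(𝒞 × L) ≤ #L := by
    rw [mk_prod, lift_id, lift_id]
    exact (mul_le_mul_left (h𝒞.card_le.trans hL.ge) _).trans (mul_eq_self hLω).le
  obtain ⟨D, hxD, hD, hcl⟩ := exists_enumerated_closed hL hJ
    (fun j b => e j.1 (b (Classical.arbitrary K)) j.2) x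
  refine ⟨D, hxD, fun C hC y hy => ?_, hD⟩
  refine closure_mono (Set.inter_subset_inter_left _ ?_) (he ⟨C, hC⟩ y)
  rintro _ ⟨l, rfl⟩
  exact hcl (⟨C, hC⟩, l) (fun _ => y) fun _ => hy

end Saturated

/-! ### The free-sequence argument. -/

/-- A family `𝒵` of closed sets that is closed under intersections of `K` members, and in which
each member can be shrunk off any closed set not containing its image, has a member whose image
lies in the closure of a set of cardinality at most `2 ^ #K`. -/
theorem exists_image_subset_closure {X : Type u} [TopologicalSpace X] {K L : Type u} [Infinite K]
    {𝒞 : Set (Set X)} (hL : #L = 2 ^ #K) (h𝒞 : IsWeakTightnessCover #K 𝒞)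
    {Y : Type v} [TopologicalSpace Y] [CompactSpace Y] {f : Y → X} (hf : Continuous f)
    {𝒵 : Set (Set Y)} {Z₀ : Set Y} (hZ₀ : Z₀ ∈ 𝒵) (hclosed : ∀ Z ∈ 𝒵, IsClosed Z)
    (hne : ∀ Z ∈ 𝒵, Z.Nonempty)
    (hinter : ∀ s : K → Set Y, (∀ k, s k ∈ 𝒵) → (⋂ k, s k).Nonempty → ⋂ k, s k ∈ 𝒵)
    (hshrink : ∀ Z ∈ 𝒵, ∀ T : Set X, IsClosed T → ¬ f '' Z ⊆ T →
      ∃ Z' ∈ 𝒵, Z' ⊆ Z ∧ ∀ y ∈ Z', f y ∉ T) :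
    ∃ Z ∈ 𝒵, ∃ H : Set X, EnumeratedBy L H ∧ f '' Z ⊆ closure H := by
  by_contra! hcon
  have hKω : ℵ₀ ≤ #K := aleph0_le_mk K
  have hLω : ℵ₀ ≤ #L := hL ▸ hKω.trans (cantor _).le
  have : Infinite L := infinite_iff.2 hLω
  obtain ⟨y₀, -⟩ := hne _ hZ₀
  have : Nonempty X := ⟨f y₀⟩
  have : Nonempty Y := ⟨y₀⟩
  have hξ : ∀ (Z : Set Y) (H : Set X), ∃ Z' : Set Y, Z ∈ 𝒵 → EnumeratedBy L H →
      Z' ∈ 𝒵 ∧ Z' ⊆ Z ∧ ∀ y ∈ Z', f y ∉ closure H := by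
    intro Z H
    by_cases h : Z ∈ 𝒵 ∧ EnumeratedBy L H
    · obtain ⟨Z', h1, h2⟩ := hshrink Z h.1 _ isClosed_closure (hcon Z h.1 H h.2)
      exact ⟨Z', fun _ _ => ⟨h1, h2⟩⟩
    · exact ⟨Z, fun h1 h2 => absurd ⟨h1, h2⟩ h⟩
  choose ξ hξ using hξ
  have hpt : ∀ Z : Set Y, ∃ y, Z ∈ 𝒵 → y ∈ Z := fun Z => by
    by_cases h : Z ∈ 𝒵
    · exact (hne Z h).imp fun y hy _ => hy
    · exact ⟨y₀, fun h' => absurd h' h⟩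
  choose pt hpt using hpt
  choose hull hxhull hsat hhull using exists_saturated_superset hL h𝒞
  let I := (Order.succ #K).ord.ToType
  have hI : #I = Order.succ #K := mk_ord_toType _
  have : Nonempty I := by
    rw [← mk_ne_zero_iff, hI]
    exact (succ_pos _).ne'
  have hIio : ∀ α : I, #(Set.Iio α) ≤ #K := fun α =>
    Order.lt_succ_iff.1
      ((mk_Iio_lt α (by rw [hI]; exact (Ordinal.type_toType _).symm)).trans_eq hI)
  -- Stage `α` shrinks the intersection of the earlier sets off the closure of the hulls of the
  -- points chosen earlier. `Z₀` serves the first stage, where that intersection is everything.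
  let step : (α : I) → ((β : I) → β < α → Set Y) → Set Y := fun α F =>
    ξ (Z₀ ∩ ⋂ (β : Set.Iio α), F β β.2) (⋃ β : Set.Iio α, hull (f (pt (F β β.2))))
  let g : I → Set Y := (wellFounded_lt (α := I)).fix step
  have hg : ∀ α, g α = ξ (Z₀ ∩ ⋂ β : Set.Iio α, g β) (⋃ β : Set.Iio α, hull (f (pt (g β)))) :=
    fun α => WellFounded.fix_eq _ step α
  have hH : ∀ α : I, EnumeratedBy L (⋃ β : Set.Iio α, hull (f (pt (g β)))) := by
    intro α
    rcases isEmpty_or_nonempty (Set.Iio α) with h | h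
    · rw [Set.iUnion_of_empty]
      exact EnumeratedBy.of_countable Set.countable_empty
    · exact EnumeratedBy.iUnion (EnumeratedBy.of_mk_le
        (mk_univ.trans_le ((hIio α).trans (hL ▸ (cantor _).le)))) fun β => hhull _
  have main : ∀ α, g α ∈ 𝒵 ∧ g α ⊆ Z₀ ∩ ⋂ β : Set.Iio α, g β ∧
      ∀ y ∈ g α, f y ∉ closure (⋃ β : Set.Iio α, hull (f (pt (g β)))) := by
    intro α
    induction α using (wellFounded_lt (α := I)).induction with
    | _ α ih =>
      have hmem : Z₀ ∩ ⋂ β : Set.Iio α, g β ∈ 𝒵 := by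
        rcases isEmpty_or_nonempty (Set.Iio α) with h | h
        · simpa using hZ₀
        · have hZ : Z₀ ∩ ⋂ β : Set.Iio α, g β = ⋂ β : Set.Iio α, g β :=
            Set.inter_eq_right.2 ((Set.iInter_subset _ h.some).trans
              ((ih h.some h.some.2).2.1.trans Set.inter_subset_left))
          have hanti : Antitone fun β : Set.Iio α => g β := by
            intro β γ hβγ
            rcases hβγ.eq_or_lt with rfl | hlt
            · exact subset_rfl
            · exact (ih γ γ.2).2.1.trans (Set.inter_subset_right.trans
                (Set.iInter_subset (fun δ : Set.Iio (γ : I) => g δ) ⟨β, hlt⟩))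
          have hnon := IsCompact.nonempty_iInter_of_directed_nonempty_isCompact_isClosed
            (fun β : Set.Iio α => g β) hanti.directed_ge (fun β => hne _ (ih β β.2).1)
            (fun β => (hclosed _ (ih β β.2).1).isCompact) fun β => hclosed _ (ih β β.2).1
          obtain ⟨e, he⟩ := (EnumeratedBy.of_mk_le (K := K) (A := (Set.univ : Set (Set.Iio α)))
            (mk_univ.trans_le (hIio α))).exists_range_eq Set.univ_nonempty
          have hesurj : Function.Surjective e := Set.range_eq_univ.1 he
          rw [hZ]
          rw [← hesurj.iInter_comp] at hnon ⊢
          exact hinter _ (fun k => (ih _ (e k).2).1) hnon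
      have := hξ _ _ hmem (hH α)
      rwa [← hg] at this
  have hsub : ∀ β α : I, β ≤ α → g α ⊆ g β := by
    intro β α hβα
    rcases hβα.eq_or_lt with rfl | hlt
    · exact subset_rfl
    · exact (main α).2.1.trans (Set.inter_subset_right.trans
        (Set.iInter_subset (fun δ : Set.Iio α => g δ) ⟨β, hlt⟩))
  have hptg : ∀ α, pt (g α) ∈ g α := fun α => hpt _ (main α).1
  -- A cluster point of the tails lies in every `g α`, since these are closed and decreasing.
  obtain ⟨y, hy⟩ : (⋂ α : I, closure ((fun β => pt (g β)) '' Set.Ici α)).Nonempty := by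
    refine IsCompact.nonempty_iInter_of_directed_nonempty_isCompact_isClosed _
      (Antitone.directed_ge ?_) ?_ (fun α => isClosed_closure.isCompact) fun α => isClosed_closure
    · exact fun α β h => closure_mono (Set.image_mono (Set.Ici_subset_Ici.2 h))
    · exact fun α => ⟨_, subset_closure ⟨α, Set.self_mem_Ici, rfl⟩⟩
  rw [Set.mem_iInter] at hy
  have hyg : ∀ α, y ∈ g α := fun α => by
    refine closure_minimal ?_ (hclosed _ (main α).1) (hy α)
    rintro _ ⟨β, hβ, rfl⟩
    exact hsub α β hβ (hptg β)
  have hfy : f y ∈ closure (⋃ α : I, hull (f (pt (g α)))) := by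
    have := image_closure_subset_closure_image hf
      (Set.mem_image_of_mem f (hy (Classical.arbitrary I)))
    refine closure_mono ?_ this
    rintro _ ⟨_, ⟨β, -, rfl⟩, rfl⟩
    exact Set.mem_iUnion.2 ⟨β, hxhull _⟩
  obtain ⟨B, hBS, hB, hyB⟩ :=
    (IsSaturated.iUnion fun α : I => hsat (f (pt (g α)))).exists_enumerated h𝒞 hfy
  obtain ⟨e, he⟩ := hB
  have hBI : ∀ b : B, ∃ α : I, (b : X) ∈ hull (f (pt (g α))) := fun b =>
    Set.mem_iUnion.1 (hBS b.2)
  choose idx hidx using hBI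
  -- Regularity of `κ⁺`: at most `κ` initial segments of size at most `κ` cannot cover `I`.
  obtain ⟨γ, hγ⟩ : ∃ γ, ∀ b, idx b < γ := by
    by_contra! hunb
    have huniv : EnumeratedBy K (⋃ b : B, Set.Iic (idx b)) := by
      refine EnumeratedBy.iUnion ?_ fun b => ?_
      · have : Nonempty B := ⟨(hunb (Classical.arbitrary I)).choose⟩
        exact EnumeratedBy.of_mk_le (mk_univ.trans_le (EnumeratedBy.mk_le ⟨e, he⟩))
      · rw [← Set.Iio_union_right]
        exact (EnumeratedBy.of_mk_le (hIio _)).union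
          (EnumeratedBy.of_countable (Set.countable_singleton _))
    have hcover : (⋃ b : B, Set.Iic (idx b)) = Set.univ := Set.eq_univ_of_forall fun α =>
      let ⟨b, hb⟩ := hunb α
      Set.mem_iUnion.2 ⟨b, hb⟩
    have := huniv.mk_le
    rw [hcover, mk_univ, hI] at this
    exact (Order.lt_succ #K).not_ge this
  refine (main γ).2.2 y (hyg γ) (closure_mono (fun b hb => ?_) hyB)
  exact Set.mem_iUnion.2 ⟨⟨idx ⟨b, hb⟩, hγ _⟩, hidx ⟨b, hb⟩⟩

/-! ### Small zero loci and control by few coordinates. -/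

section

variable {X : Type u} [TopologicalSpace X] [CompactSpace X] {K L : Type u} [Infinite K]
  {𝒞 : Set (Set X)}

theorem nonempty_equiv_prod_self (K : Type u) [Infinite K] : Nonempty (K ≃ K × K) := by
  rw [← Cardinal.eq, mk_prod, lift_id, mul_eq_self (aleph0_le_mk K)]

theorem nonempty_equiv_option (K : Type u) [Infinite K] : Nonempty (K ≃ Option K) := by
  rw [← Cardinal.eq, mk_option, add_one_of_aleph0_le (aleph0_le_mk K)]

theorem nonempty_equiv_prod_nat (K : Type u) [Infinite K] : Nonempty (K ≃ K × ℕ) := by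
  rw [← Cardinal.eq, mk_prod, lift_id'.{0, u}, mk_nat, lift_aleph0,
    mul_eq_left (aleph0_le_mk K) (aleph0_le_mk K) aleph0_ne_zero]

/-- A nonempty intersection of `#K` zero sets inside the closure of a set of cardinality at most
`2 ^ #K`. -/
theorem exists_zeroLocus_subset_closure [T2Space X] [Nonempty X] (hL : #L = 2 ^ #K)
    (h𝒞 : IsWeakTightnessCover #K 𝒞) :
    ∃ φ : K → C(X, ℝ), {x | ∀ k, φ k x = 0}.Nonempty ∧
      ∃ H : Set X, EnumeratedBy L H ∧ {x | ∀ k, φ k x = 0} ⊆ closure H := by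
  let 𝒵 : Set (Set X) := {Z | Z.Nonempty ∧ ∃ φ : K → C(X, ℝ), Z = {x | ∀ k, φ k x = 0}}
  obtain ⟨Z, ⟨hZ, φ, rfl⟩, H, hH, hZH⟩ := exists_image_subset_closure hL h𝒞 (Y := X)
    continuous_id (𝒵 := 𝒵) (Z₀ := Set.univ) ⟨Set.univ_nonempty, fun _ => 0, by simp⟩
    (by
      rintro _ ⟨-, φ, rfl⟩
      simp only [Set.ofPred_forall]
      exact isClosed_iInter fun k => isClosed_eq (φ k).continuous continuous_const)
    (fun Z hZ => hZ.1)
    (by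
      intro s hs hne
      choose φ hφ using fun k => (hs k).2
      obtain ⟨E⟩ := nonempty_equiv_prod_self K
      refine ⟨hne, fun k => φ (E k).1 (E k).2, ?_⟩
      ext x
      simp only [Set.mem_iInter, hφ, Set.mem_ofPred_eq]
      refine ⟨fun h k => h _ _, fun h k l => ?_⟩
      simpa using h (E.symm (k, l)))
    (by
      rintro _ ⟨-, φ, rfl⟩ T hT hnot
      rw [Set.image_id, Set.not_subset] at hnot
      obtain ⟨x, hx, hxT⟩ := hnot
      obtain ⟨ψ, h0, h1, -⟩ := exists_continuous_zero_one_of_isClosed (isClosed_singleton (x := x))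
        hT (Set.disjoint_singleton_left.2 hxT)
      obtain ⟨E⟩ := nonempty_equiv_option K
      refine ⟨{x | ∀ k, (E k).elim ψ φ x = 0}, ⟨⟨x, fun k => ?_⟩, _, rfl⟩, fun z hz k => ?_,
        fun z hz hzT => ?_⟩
      · rcases E k with _ | k
        exacts [h0 rfl, hx k]
      · simpa using hz (E.symm (some k))
      · have : ψ z = 0 := by simpa using hz (E.symm none)
        exact one_ne_zero ((h1 hzT).symm.trans this))
  exact ⟨φ, hZ, H, hH, by simpa using hZH⟩

/-- If `f : X ^ ι → X` is continuous, then fixing suitable `#K` coordinates of a point confines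
the values of `f` to the closure of a set of cardinality at most `2 ^ #K`. -/
theorem exists_coordinates_subset_closure (hL : #L = 2 ^ #K) (h𝒞 : IsWeakTightnessCover #K 𝒞)
    [T2Space X] {ι : Type v} [Nonempty ι] {f : (ι → X) → X} (hf : Continuous f) (t : ι → X) :
    ∃ A : Set ι, EnumeratedBy K A ∧ ∃ H : Set X, EnumeratedBy L H ∧
      ∀ u, (∀ a ∈ A, u a = t a) → f u ∈ closure H := by
  have hKω : ℵ₀ ≤ #K := aleph0_le_mk K
  have hLω : ℵ₀ ≤ #L := hL ▸ hKω.trans (cantor _).le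
  have : Infinite L := infinite_iff.2 hLω
  have : Nonempty X := ⟨f t⟩
  -- The shrinking argument controls only some `w` agreeing with `t` on a prescribed `A₀`, not `t`
  -- itself; iterating `ω` times repairs this.
  have dense_good : ∀ A₀ : Set ι, EnumeratedBy K A₀ → ∃ w : ι → X, (∀ a ∈ A₀, w a = t a) ∧
      ∃ A : Set ι, EnumeratedBy K A ∧ ∃ H : Set X, EnumeratedBy L H ∧
        ∀ u, (∀ a ∈ A, u a = w a) → f u ∈ closure H := by
    intro A₀ hA₀
    let 𝒵 : Set (Set (ι → X)) := {Z | ∃ (A : Set ι) (w : ι → X), EnumeratedBy K A ∧ A₀ ⊆ A ∧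
      (∀ a ∈ A₀, w a = t a) ∧ Z = {u | ∀ a ∈ A, u a = w a}}
    obtain ⟨_, ⟨A, w, hA, hA₀A, hw, rfl⟩, H, hH, hZH⟩ := exists_image_subset_closure hL h𝒞 hf
      (𝒵 := 𝒵) ⟨A₀, t, hA₀, subset_rfl, fun _ _ => rfl, rfl⟩
      (by
        rintro _ ⟨A, w, -, -, -, rfl⟩
        simp only [Set.ofPred_forall]
        exact isClosed_biInter fun a _ => isClosed_eq (continuous_apply a) continuous_const)
      (by
        rintro _ ⟨A, w, -, -, -, rfl⟩
        exact ⟨w, fun _ _ => rfl⟩)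
      (by
        rintro s hs ⟨w, hw⟩
        choose A v hA hA₀A hv hs using hs
        simp only [hs, Set.mem_iInter, Set.mem_ofPred_eq] at hw
        refine ⟨⋃ k, A k, w, EnumeratedBy.iUnion ⟨id, by simp⟩ hA,
          (hA₀A (Classical.arbitrary K)).trans (Set.subset_iUnion _ _), fun a ha => ?_, ?_⟩
        · rw [hw (Classical.arbitrary K) a (hA₀A _ ha), hv _ a ha]
        · ext u
          simp only [hs, Set.mem_iInter, Set.mem_ofPred_eq, Set.mem_iUnion]
          exact ⟨fun h a ⟨k, ha⟩ => (h k a ha).trans (hw k a ha).symm,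
            fun h k a ha => (h a ⟨k, ha⟩).trans (hw k a ha)⟩)
      (by
        rintro _ ⟨A, w, hA, hA₀A, hw, rfl⟩ T hT hnot
        obtain ⟨_, ⟨u, hu, rfl⟩, huT⟩ := Set.not_subset.1 hnot
        obtain ⟨F, N, hN, hNT⟩ := isOpen_pi_iff.1 (hT.isOpen_compl.preimage hf) u huT
        refine ⟨{v | ∀ a ∈ A ∪ F, v a = u a}, ⟨A ∪ F, u,
          hA.union (EnumeratedBy.of_countable F.countable_toSet),
          hA₀A.trans Set.subset_union_left, fun a ha => (hu a (hA₀A ha)).trans (hw a ha), rfl⟩,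
          fun v hv a ha => (hv a (Or.inl ha)).trans (hu a ha), fun v hv => hNT fun a ha => ?_⟩
        rw [hv a (Or.inr ha)]
        exact (hN a ha).2)
    exact ⟨w, hw, A, hA, H, hH, fun u hu => hZH ⟨u, hu, rfl⟩⟩
  choose w hw A hA H hH hfH using dense_good
  let 𝒜 : ℕ → {A : Set ι // EnumeratedBy K A} := fun n => Nat.rec
    ⟨∅, EnumeratedBy.of_countable Set.countable_empty⟩
    (fun _ B => ⟨B.1 ∪ A B.1 B.2, B.2.union (hA B B.2)⟩) n
  have h𝒜 : ∀ n, (𝒜 (n + 1)).1 = (𝒜 n).1 ∪ A (𝒜 n).1 (𝒜 n).2 := fun n => rfl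
  have hmono : Monotone fun n => (𝒜 n).1 :=
    monotone_nat_of_le_succ fun n => (Set.subset_union_left.trans (h𝒜 n).ge)
  have hℕ : EnumeratedBy K (Set.univ : Set ℕ) := EnumeratedBy.of_countable Set.countable_univ
  refine ⟨⋃ n, (𝒜 n).1, EnumeratedBy.iUnion hℕ fun n => (𝒜 n).2,
    ⋃ n, H (𝒜 n).1 (𝒜 n).2, EnumeratedBy.iUnion
      (EnumeratedBy.of_countable Set.countable_univ) fun n => hH _ _, fun u hu => ?_⟩
  by_contra hfu
  obtain ⟨F, N, hN, hNT⟩ := isOpen_pi_iff.1 (isClosed_closure.isOpen_compl.preimage hf) u hfu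
  classical
  obtain ⟨n, hn⟩ := hmono.directed_le.exists_mem_subset_of_finset_subset_biUnion
    (s := F.filter (· ∈ ⋃ n, (𝒜 n).1)) (fun a ha => (Finset.mem_filter.1 ha).2)
  -- Coordinates in `F` that belong to `𝒜 (n + 1)` already belong to `𝒜 n`, where `w`, `t` and `u`
  -- agree; so `v` stays in the neighbourhood of `u`.
  let v : ι → X := fun a => if a ∈ (𝒜 (n + 1)).1 then w _ (𝒜 n).2 a else u a
  have hv : v ∈ (F : Set ι).pi N := by
    intro a ha
    by_cases hmem : a ∈ (𝒜 (n + 1)).1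
    · have haU : a ∈ ⋃ n, (𝒜 n).1 := Set.mem_iUnion.2 ⟨n + 1, hmem⟩
      have han : a ∈ (𝒜 n).1 := hn (Finset.mem_filter.2 ⟨ha, haU⟩)
      simp only [v, if_pos hmem]
      rw [hw _ _ a han, ← hu a haU]
      exact (hN a ha).2
    · simp only [v, if_neg hmem]
      exact (hN a ha).2
  refine hNT hv (closure_mono (Set.subset_iUnion (fun n => H (𝒜 n).1 (𝒜 n).2) n)
    (hfH _ _ v fun a ha => if_pos ?_))
  rw [h𝒜]
  exact Or.inr ha

end

/-! ### Separating points and reflecting zero sets. -/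

section

variable {X : Type u} [TopologicalSpace X] {K L : Type u} [Infinite K] {𝒞 : Set (Set X)}

/-- At most `2 ^ #K` closed sets separate the points of an intersection of `#K` zero sets from all
other points, provided the intersection lies in the closure of a set of cardinality at most
`2 ^ #K`. -/
theorem exists_separating_family [CompactSpace X] [T2Space X] (hL : #L = 2 ^ #K)
    (h𝒞 : IsWeakTightnessCover #K 𝒞) (φ : K → C(X, ℝ)) {H : Set X} (hH : EnumeratedBy L H)
    (hφH : {x | ∀ k, φ k x = 0} ⊆ closure H) :
    ∃ Q : L → Set X, (∀ l, IsClosed (Q l)) ∧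
      ∀ u g, (∀ k, φ k g = 0) → u ≠ g → ∃ l, u ∈ interior (Q l) ∧ g ∉ Q l := by
  have hKω : ℵ₀ ≤ #K := aleph0_le_mk K
  have hLω : ℵ₀ ≤ #L := hL ▸ hKω.trans (cantor _).le
  have : Infinite L := infinite_iff.2 hLω
  obtain ⟨e, he⟩ := hH
  have : Nonempty X := ⟨e (Classical.arbitrary L)⟩
  choose hull hxhull hsat hhull using exists_saturated_superset hL h𝒞
  have hS : EnumeratedBy L (⋃ l, hull (e l)) :=
    EnumeratedBy.iUnion ⟨id, by simp⟩ fun l => hhull (e l)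
  have hSsat : IsSaturated 𝒞 (⋃ l, hull (e l)) := IsSaturated.iUnion fun l => hsat (e l)
  have hHS : closure H ⊆ closure (⋃ l, hull (e l)) := closure_mono fun x hx => by
    obtain ⟨l, rfl⟩ := he hx
    exact Set.mem_iUnion.2 ⟨l, hxhull _⟩
  obtain ⟨d, hd⟩ := hS.exists_range_eq
    ⟨_, Set.mem_iUnion.2 ⟨Classical.arbitrary L, hxhull _⟩⟩
  -- An index codes two subsets of the saturated set, each of size at most `κ`; there are `2 ^ κ`
  -- indices. When the closures meet, the value `∅` is a default.
  have hW : ∀ q : (K → L) × Set K × Set K, ∃ W : Set X, IsOpen W ∧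
      (Disjoint (closure ((fun k => d (q.1 k)) '' q.2.1))
        (closure ((fun k => d (q.1 k)) '' q.2.2)) →
        closure ((fun k => d (q.1 k)) '' q.2.1) ⊆ W ∧
        Disjoint (closure W) (closure ((fun k => d (q.1 k)) '' q.2.2))) := by
    intro q
    by_cases hq : Disjoint (closure ((fun k => d (q.1 k)) '' q.2.1))
      (closure ((fun k => d (q.1 k)) '' q.2.2))
    · obtain ⟨W, hWo, hW1, hW2⟩ := normal_exists_closure_subset isClosed_closure
        isClosed_closure.isOpen_compl hq.subset_compl_right
      exact ⟨W, hWo, fun _ => ⟨hW1, Set.disjoint_left.2 fun x hx => hW2 hx⟩⟩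
    · exact ⟨∅, isOpen_empty, fun h => absurd h hq⟩
  choose W hWo hW using hW
  let Q₁ : K × ℕ → Set X := fun q => {x | 1 / ((q.2 : ℝ) + 1) ≤ |φ q.1 x|}
  have hKL : EnumeratedBy L (Set.univ : Set K) :=
    EnumeratedBy.of_mk_le (mk_univ.trans_le (hL ▸ (cantor _).le))
  have h₁ : EnumeratedBy L (Set.range Q₁) := by
    obtain ⟨E⟩ := nonempty_equiv_prod_nat K
    exact hKL.trans ⟨Q₁ ∘ E, (E.surjective.range_comp Q₁).ge⟩
  have h₂ : EnumeratedBy L (Set.range fun q => closure (W q)) := by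
    refine EnumeratedBy.trans (EnumeratedBy.of_mk_le ?_) (EnumeratedBy.range _)
    have hω : ℵ₀ ≤ (2 : Cardinal.{u}) ^ #K := hL ▸ hLω
    simp only [mk_univ, mk_prod, lift_id]
    rw [← power_def, mk_set, hL, ← power_mul, mul_eq_self hKω, mul_eq_self hω, mul_eq_self hω]
  obtain ⟨Q, hQ⟩ := (h₁.union h₂).exists_range_eq
    ⟨_, Or.inl ⟨(Classical.arbitrary K, 0), rfl⟩⟩
  refine ⟨Q, fun l => ?_, fun u g hg hug => ?_⟩
  · rcases hQ.le ⟨l, rfl⟩ with ⟨q, hq⟩ | ⟨q, hq⟩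
    · rw [← hq]
      exact isClosed_le continuous_const (φ q.1).continuous.abs
    · rw [← hq]
      exact isClosed_closure
  suffices ∃ P ∈ Set.range Q₁ ∪ Set.range fun q => closure (W q), u ∈ interior P ∧ g ∉ P by
    obtain ⟨P, hP, h⟩ := this
    obtain ⟨l, rfl⟩ := hQ.ge hP
    exact ⟨l, h⟩
  by_cases hu : ∀ k, φ k u = 0
  · obtain ⟨Bu, hBuS, hBu, huB⟩ := hSsat.exists_enumerated h𝒞 (hHS (hφH hu))
    obtain ⟨Bg, hBgS, hBg, hgB⟩ := hSsat.exists_enumerated h𝒞 (hHS (hφH hg))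
    obtain ⟨b, hb⟩ := (hBu.union hBg).exists_range_eq
      ((closure_nonempty_iff.1 ⟨u, huB⟩).mono Set.subset_union_left)
    have hbd : ∀ k, ∃ l, d l = b k := fun k => by
      have : b k ∈ ⋃ l, hull (e l) := Set.union_subset hBuS hBgS (hb.le ⟨k, rfl⟩)
      exact hd.ge this
    choose β hβ using hbd
    obtain ⟨U, V, hU, hV, huU, hgV, hUV⟩ := t2_separation hug
    obtain ⟨U', hU', hU'c, hU'U⟩ := exists_mem_nhds_isClosed_subset (hU.mem_nhds huU)
    obtain ⟨V', hV', hV'c, hV'V⟩ := exists_mem_nhds_isClosed_subset (hV.mem_nhds hgV)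
    have himage : ∀ (B N : Set X) (x : X), x ∈ closure B → B ⊆ Set.range b → N ∈ nhds x →
        x ∈ closure ((fun k => d (β k)) '' {k | b k ∈ N}) := by
      intro B N x hx hB hN
      rw [mem_closure_iff_nhds] at hx ⊢
      intro O hO
      obtain ⟨z, ⟨hzO, hzN⟩, hzB⟩ := hx _ (Filter.inter_mem hO hN)
      obtain ⟨k, rfl⟩ := hB hzB
      exact ⟨b k, hzO, k, hzN, hβ k⟩
    have hsub : ∀ N : Set X, IsClosed N → closure ((fun k => d (β k)) '' {k | b k ∈ N}) ⊆ N := by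
      intro N hN
      refine closure_minimal ?_ hN
      rintro _ ⟨k, hk, rfl⟩
      have hkN : b k ∈ N := hk
      simpa only [hβ] using hkN
    obtain ⟨h1, h2⟩ := hW (β, {k | b k ∈ U'}, {k | b k ∈ V'})
      (hUV.mono ((hsub U' hU'c).trans hU'U) ((hsub V' hV'c).trans hV'V))
    refine ⟨_, Or.inr ⟨(β, {k | b k ∈ U'}, {k | b k ∈ V'}), rfl⟩,
      interior_mono subset_closure ?_, ?_⟩
    · rw [(hWo _).interior_eq]
      exact h1 (himage Bu U' u huB (Set.subset_union_left.trans hb.ge) hU')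
    · exact Set.disjoint_right.1 h2
        (himage Bg V' g hgB (Set.subset_union_right.trans hb.ge) hV')
  · push Not at hu
    obtain ⟨k, hk⟩ := hu
    obtain ⟨m, hm⟩ := exists_nat_one_div_lt (abs_pos.2 hk)
    refine ⟨_, Or.inl ⟨(k, m), rfl⟩, ?_, ?_⟩
    · refine mem_interior.2 ⟨{x | 1 / ((m : ℝ) + 1) < |φ k x|}, fun x hx => le_of_lt (α := ℝ) hx,
        isOpen_lt continuous_const (φ k).continuous.abs, hm⟩
    · simp only [Q₁, Set.mem_ofPred_eq, hg k, abs_zero, not_le]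
      positivity

/-- A point of the closure of a saturated set `D` lying in an intersection of `#K` zero sets lies
in the intersection of the closures of `#K` subsets of `D`, of cardinality at most `#K`, which is
contained in the given intersection. -/
theorem IsSaturated.exists_family_iInter_closure (h𝒞 : IsWeakTightnessCover #K 𝒞) {D : Set X}
    (hD : IsSaturated 𝒞 D) {n : X} (hn : n ∈ closure D) (ψ : K → C(X, ℝ))
    (hψ : ∀ k, ψ k n = 0) :
    ∃ β : K → K → X, (∀ i k, β i k ∈ D) ∧ (∀ i, n ∈ closure (Set.range (β i))) ∧
      ∀ z, (∀ i, z ∈ closure (Set.range (β i))) → ∀ k, ψ k z = 0 := by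
  have key : ∀ q : K × ℕ, ∃ b : K → X, Set.range b ⊆ D ∩ {x | |ψ q.1 x| < 1 / ((q.2 : ℝ) + 1)} ∧
      n ∈ closure (Set.range b) := by
    intro q
    have hO : IsOpen {x | |ψ q.1 x| < 1 / ((q.2 : ℝ) + 1)} :=
      isOpen_lt (ψ q.1).continuous.abs continuous_const
    have hnO : n ∈ {x | |ψ q.1 x| < 1 / ((q.2 : ℝ) + 1)} := by
      simp only [Set.mem_ofPred_eq, hψ, abs_zero]
      positivity
    have hnD : n ∈ closure (D ∩ {x | |ψ q.1 x| < 1 / ((q.2 : ℝ) + 1)}) := by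
      rw [Set.inter_comm]
      exact hO.inter_closure ⟨hnO, hn⟩
    obtain ⟨B, hBD, hB, hnB⟩ := (hD.inter_isOpen hO).exists_enumerated h𝒞 hnD
    obtain ⟨b, rfl⟩ := hB.exists_range_eq (closure_nonempty_iff.1 ⟨n, hnB⟩)
    exact ⟨b, hBD, hnB⟩
  choose b hbD hb using key
  obtain ⟨E⟩ := nonempty_equiv_prod_nat K
  refine ⟨fun i => b (E i), fun i k => (hbD _ ⟨k, rfl⟩).1, fun i => hb _, fun z hz k => ?_⟩
  by_contra hne
  obtain ⟨m, hm⟩ := exists_nat_one_div_lt (abs_pos.2 hne)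
  have hzm : z ∈ closure (Set.range (b (E (E.symm (k, m))))) := hz _
  rw [E.apply_symm_apply] at hzm
  have : z ∈ {x | |ψ k x| ≤ 1 / ((m : ℝ) + 1)} :=
    closure_minimal (fun x hx => le_of_lt (α := ℝ) (hbD (k, m) hx).2)
      (isClosed_le (ψ k).continuous.abs continuous_const) hzm
  exact (hm.trans_le this).false

end

/-! ### The dense set. -/

/-- A compact Hausdorff space with a homogeneous power, and with a weak tightness cover for `#K`,
has a dense subset of cardinality at most `2 ^ #K`. -/
theorem exists_dense_enumerated {X : Type u} [TopologicalSpace X] [CompactSpace X] [T2Space X]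
    [Nonempty X] {K L : Type u} [Infinite K] (hL : #L = 2 ^ #K) {𝒞 : Set (Set X)}
    (h𝒞 : IsWeakTightnessCover #K 𝒞) {ι : Type v} [Nonempty ι]
    (hom : IsHomogeneousSpace (ι → X)) : ∃ D : Set X, Dense D ∧ EnumeratedBy L D := by
  classical
  have hKω : ℵ₀ ≤ #K := aleph0_le_mk K
  have hLω : ℵ₀ ≤ #L := hL ▸ hKω.trans (cantor _).le
  have : Infinite L := infinite_iff.2 hLω
  obtain ⟨φ, ⟨p, hp⟩, H₀, hH₀, hφH₀⟩ := exists_zeroLocus_subset_closure hL h𝒞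
  obtain ⟨Q, hQc, hQ⟩ := exists_separating_family hL h𝒞 φ hH₀ hφH₀
  choose hull hxhull hsat hhull using exists_saturated_superset hL h𝒞
  choose eS heS using fun x => (hhull x).exists_range_eq ⟨x, hxhull x⟩
  choose h hh using fun x : X => hom (fun _ => x) (fun _ => p)
  let j : ι := Classical.arbitrary ι
  let z : X → X → ι → X := fun x v => h x (Function.update (fun _ => x) j v)
  have hz : ∀ x a, Continuous fun v => z x v a := fun x a => (continuous_apply a).comp
    ((h x).continuous.comp (continuous_const.update j continuous_id))
  have hzx : ∀ x a, z x x a = p := fun x a => by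
    have : Function.update (fun _ => x) j x = (fun _ : ι => x) := Function.update_eq_self j _
    simp only [z, this, hh]
  let f : X → (ι → X) → X := fun x u => (h x).symm u j
  have hf : ∀ x, Continuous (f x) := fun x => (continuous_apply j).comp (h x).symm.continuous
  have hfz : ∀ x v, f x (z x v) = v := fun x v => by simp [f, z]
  choose A hA H hH hW using fun x s => exists_coordinates_subset_closure hL h𝒞 (hf x) (z x s)
  choose α hα using hA
  choose eH heH using hH
  let k₀ : K := Classical.arbitrary K
  obtain ⟨k₁, hk₁⟩ := exists_ne k₀
  obtain ⟨E⟩ : Nonempty (K ≃ Option K × K) := by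
    obtain ⟨E₁⟩ := nonempty_equiv_prod_self K
    obtain ⟨E₂⟩ := nonempty_equiv_option K
    exact ⟨E₁.trans (E₂.prodCongr (Equiv.refl K))⟩
  -- The relevant coordinates of `z x v` lie in `G`. This always holds for `x = v`.
  let Good : X → (K → X) → X → Prop := fun x b v => ∀ i k l, φ l (z x v (α x (b i) k)) = 0
  -- Through `E`, `b` codes one sequence (`none`) and `K` further ones (`some i`), the closures of
  -- whose ranges are intersected.
  have hop₃ : ∀ b : K → X, ∃ x, ∀ x', (∀ v, (∀ i, v ∈ closure (Set.range fun k =>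
      b (E.symm (some i, k)))) → Good x' (fun k => b (E.symm (none, k))) v) →
      (∀ v, (∀ i, v ∈ closure (Set.range fun k => b (E.symm (some i, k)))) →
        Good x (fun k => b (E.symm (none, k))) v) := by
    intro b
    by_cases hb : ∃ x', ∀ v, (∀ i, v ∈ closure (Set.range fun k =>
      b (E.symm (some i, k)))) → Good x' (fun k => b (E.symm (none, k))) v
    · exact hb.imp fun x hx _ _ => hx
    · exact ⟨p, fun x' hx' => absurd ⟨x', hx'⟩ hb⟩
  choose op₃ hop₃ using hop₃
  have hop₄ : ∀ (s : Finset (K × K × K × L)) (b : K → X), ∃ o, ∀ v,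
      (∀ q ∈ s, z (b q.1) v (α (b q.1) (b q.2.1) q.2.2.1) ∈ interior (Q q.2.2.2)) →
      ∀ q ∈ s, z (b q.1) o (α (b q.1) (b q.2.1) q.2.2.1) ∈ interior (Q q.2.2.2) := by
    intro s b
    by_cases hs : ∃ v, ∀ q ∈ s, z (b q.1) v (α (b q.1) (b q.2.1) q.2.2.1) ∈ interior (Q q.2.2.2)
    · exact hs.imp fun v hv _ _ => hv
    · exact ⟨p, fun v hv => absurd ⟨v, hv⟩ hs⟩
  choose op₄ hop₄ using hop₄
  let op : (L ⊕ L) ⊕ (PUnit.{u + 1} ⊕ Finset (K × K × K × L)) → (K → X) → X := fun i b =>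
    i.elim (fun i => i.elim (fun l => eS (b k₀) l) fun l => eH (b k₀) (b k₁) l)
      fun i => i.elim (fun _ => op₃ b) fun s => op₄ s b
  have hJ : #((L ⊕ L) ⊕ (PUnit.{u + 1} ⊕ Finset (K × K × K × L))) ≤ #L := by
    have hKL : #K * #L = #L := mul_eq_right hLω (hL ▸ (cantor _).le) (mk_ne_zero K)
    simp only [mk_sum, mk_finset_of_infinite, mk_prod, lift_id, hKL, add_eq_self hLω, mk_punit]
    rw [add_comm 1, add_one_of_aleph0_le hLω, add_eq_self hLω]
  obtain ⟨D, hpD, hD, hcl⟩ := exists_enumerated_closed hL hJ op p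
  have hDhull : ∀ x ∈ D, hull x ⊆ D := fun x hx y hy => by
    obtain ⟨l, rfl⟩ := (heS x).ge hy
    exact hcl (Sum.inl (Sum.inl l)) (fun _ => x) fun _ => hx
  have hDsat : IsSaturated 𝒞 D := by
    have : D = ⋃ x : D, hull x := Set.Subset.antisymm
      (fun x hx => Set.mem_iUnion.2 ⟨⟨x, hx⟩, hxhull x⟩) (Set.iUnion_subset fun x => hDhull x x.2)
    rw [this]
    exact IsSaturated.iUnion fun x : D => hsat x
  have hDH : ∀ x ∈ D, ∀ s ∈ D, H x s ⊆ D := fun x hx s hs y hy => by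
    obtain ⟨l, rfl⟩ := heH x s hy
    have := hcl (Sum.inl (Sum.inr l)) (fun k => if k = k₀ then x else s) fun k => by
      split_ifs
      exacts [hx, hs]
    simpa [op, hk₁] using this
  refine ⟨D, fun y => ?_, hD⟩
  by_contra hy
  -- By compactness finitely many conditions suffice; `y` satisfies them, so `op₄` finds a point of
  -- `D` that does.
  obtain ⟨n, hnD, hn⟩ : ∃ n ∈ closure D, ∀ x ∈ D, ∀ s ∈ D, ∀ k l,
      z x y (α x s k) ∈ interior (Q l) → z x n (α x s k) ∈ Q l := by
    let I := {q : D × D × K × L // z q.1 y (α q.1 q.2.1 q.2.2.1) ∈ interior (Q q.2.2.2)}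
    have hne := (isClosed_closure (s := D)).isCompact.inter_iInter_nonempty
      (fun q : I => {v | z q.1.1 v (α q.1.1 q.1.2.1 q.1.2.2.1) ∈ Q q.1.2.2.2})
      (fun q => (hQc _).preimage (hz _ _)) ?_
    · obtain ⟨n, hn, hn'⟩ := hne
      rw [Set.mem_iInter] at hn'
      exact ⟨n, hn, fun x hx s hs k l hy => hn' ⟨(⟨x, hx⟩, ⟨s, hs⟩, k, l), hy⟩⟩
    intro t
    let F : Set X := insert p (⋃ q ∈ t, {(q.1.1 : X), (q.1.2.1 : X)})
    have hF : F.Countable := by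
      refine Set.Countable.insert _ ((Finset.countable_toSet t).biUnion fun q _ => ?_)
      exact (Set.toFinite _).countable
    have hFD : F ⊆ D := by
      refine Set.insert_subset hpD (Set.iUnion₂_subset fun q _ => ?_)
      exact Set.insert_subset q.1.1.2 (Set.singleton_subset_iff.2 q.1.2.1.2)
    obtain ⟨b, hb⟩ := (EnumeratedBy.of_countable (K := K) hF).exists_range_eq
      ⟨p, Set.mem_insert _ _⟩
    have hbc : ∀ x : X, ∃ k, x ∈ F → b k = x := fun x => by
      by_cases hx : x ∈ F
      · obtain ⟨k, hk⟩ := hb.ge hx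
        exact ⟨k, fun _ => hk⟩
      · exact ⟨k₀, fun h => absurd h hx⟩
    choose c hc using hbc
    have hc₁ : ∀ q ∈ t, b (c q.1.1) = q.1.1 := fun q hq => hc _
      (Or.inr (Set.mem_biUnion hq (Or.inl rfl)))
    have hc₂ : ∀ q ∈ t, b (c q.1.2.1) = q.1.2.1 := fun q hq => hc _
      (Or.inr (Set.mem_biUnion hq (Or.inr rfl)))
    let s : Finset (K × K × K × L) :=
      t.image fun q => (c q.1.1, c q.1.2.1, q.1.2.2.1, q.1.2.2.2)
    have ho := hop₄ s b y (by
      intro q hq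
      obtain ⟨q, hqt, rfl⟩ := Finset.mem_image.1 hq
      simp only [hc₁ q hqt, hc₂ q hqt]
      exact q.2)
    refine ⟨op₄ s b, subset_closure (hcl (Sum.inr (Sum.inr s)) b fun k => hFD (hb.le ⟨k, rfl⟩)),
      Set.mem_iInter₂.2 fun q hq => ?_⟩
    have := ho _ (Finset.mem_image_of_mem _ hq)
    simp only [hc₁ q hq, hc₂ q hq] at this
    have hmem := interior_subset this
    exact hmem
  obtain ⟨B, hBD, hB, hnB⟩ := hDsat.exists_enumerated h𝒞 hnD
  obtain ⟨b₀, rfl⟩ := hB.exists_range_eq (closure_nonempty_iff.1 ⟨n, hnB⟩)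
  have hb₀ : ∀ i, b₀ i ∈ D := fun i => hBD ⟨i, rfl⟩
  -- The point `n` is itself a witness but may lie outside `D`. The sequences `β` in `D` force `Good
  -- n b₀` on their intersection of closures, so `op₃` can replace `n` by a point of `D`.
  obtain ⟨x, hxD, hx⟩ : ∃ x ∈ D, Good x b₀ n := by
    obtain ⟨E₁⟩ := nonempty_equiv_prod_self K
    let E₃ : K ≃ K × K × K := E₁.trans ((Equiv.refl K).prodCongr E₁)
    obtain ⟨β, hβD, hnβ, hβ⟩ := hDsat.exists_family_iInter_closure h𝒞 hnD
      (fun m => (φ (E₃ m).2.2).comp ⟨_, hz n (α n (b₀ (E₃ m).1) (E₃ m).2.1)⟩)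
      (fun m => by simpa [hzx] using hp _)
    let b : K → X := fun m => ((E m).1.elim b₀ β) (E m).2
    have hbD : ∀ m, b m ∈ D := fun m => by
      simp only [b]
      rcases (E m).1 with _ | i
      exacts [hb₀ _, hβD _ _]
    have hb : Good (op₃ b) (fun k => b (E.symm (none, k))) n := by
      refine hop₃ b n (fun v hv i k l => ?_) n fun i => ?_
      · have := hβ v (fun i => by simpa [b] using hv i) (E₃.symm (i, k, l))
        simpa [b] using this
      · simpa [b] using hnβ i
    exact ⟨op₃ b, hcl (Sum.inr (Sum.inl PUnit.unit)) b hbD, by simpa [b] using hb⟩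
  have heq : ∀ i k, z x n (α x (b₀ i) k) = z x y (α x (b₀ i) k) := by
    intro i k
    by_contra hne
    obtain ⟨l, hl, hl'⟩ := hQ _ _ (hx i k) (Ne.symm hne)
    exact hl' (hn x hxD _ (hb₀ i) k l hl)
  obtain ⟨F, N, hN, hNF⟩ := isOpen_pi_iff.1
    ((isClosed_closure (s := D)).isOpen_compl.preimage (hf x)) (z x y)
    (by rwa [Set.mem_preimage, hfz, Set.mem_compl_iff])
  obtain ⟨i, hi⟩ : ∃ i, ∀ a ∈ F, a ∈ ⋃ i, Set.range (α x (b₀ i)) → z x (b₀ i) a ∈ N a := by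
    have hO : IsOpen (⋂ a ∈ F.filter (· ∈ ⋃ i, Set.range (α x (b₀ i))),
        (fun v => z x v a) ⁻¹' N a) :=
      isOpen_biInter_finset fun a ha => (hN a (Finset.mem_filter.1 ha).1).1.preimage (hz x a)
    obtain ⟨_, hv, i, rfl⟩ := mem_closure_iff.1 hnB _ hO (by
      refine Set.mem_iInter₂.2 fun a ha => ?_
      obtain ⟨haF, haU⟩ := Finset.mem_filter.1 ha
      obtain ⟨i, k, rfl⟩ := Set.mem_iUnion.1 haU
      rw [Set.mem_preimage, heq]
      exact (hN _ haF).2)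
    exact ⟨i, fun a ha haU => Set.mem_iInter₂.1 hv a (Finset.mem_filter.2 ⟨ha, haU⟩)⟩
  -- `u` is close to `z x y`, yet agrees with `z x (b₀ i)` on the coordinates that force `f x u`
  -- into `closure D`.
  let u : ι → X := fun a => if a ∈ Set.range (α x (b₀ i)) then z x (b₀ i) a else z x y a
  have hu : u ∈ (F : Set ι).pi N := by
    intro a ha
    by_cases hmem : a ∈ Set.range (α x (b₀ i))
    · simp only [u, if_pos hmem]
      exact hi a ha (Set.mem_iUnion.2 ⟨i, hmem⟩)
    · simp only [u, if_neg hmem]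
      exact (hN a ha).2
  exact hNF hu (closure_mono (hDH x hxD _ (hb₀ i)) (hW x (b₀ i) u fun a ha => if_pos (hα _ _ ha)))

theorem mainTheorem7 (X : Type u) [TopologicalSpace X] [CompactSpace X] [T2Space X]
    (hX : IsPowerHomogeneous.{u, v} X) :
    density X ≤ 2 ^ weakTightness X := by
  rcases isEmpty_or_nonempty X with hempty | hne
  · have : density X ≤ #(Set.univ : Set X) := csInf_le' ⟨_, dense_univ, rfl⟩
    refine this.trans ?_
    simp
  obtain ⟨ι, hι, hom⟩ := hX
  obtain ⟨hω, 𝒞, h𝒞⟩ := weakTightness_spec X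
  have : Infinite (weakTightness X).out := infinite_iff.2 (by rwa [mk_out])
  have hL : #(Set (weakTightness X).out) = 2 ^ #(weakTightness X).out := mk_set
  obtain ⟨D, hD, hDL⟩ := exists_dense_enumerated hL (by rwa [mk_out]) hom
  calc density X ≤ #D := csInf_le' ⟨D, hD, rfl⟩
    _ ≤ #(Set (weakTightness X).out) := hDL.mk_le
    _ = 2 ^ weakTightness X := by rw [hL, mk_out]
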